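/- Fix a prime $p$ and integers $K,d,m,m'\ge 0$. A symmetric linear computation broadcast (LCBC) instance over a finite field $\mathbb{F}_q$ consists of matrices ${\bf v}_k\in\mathbb{F}_q^{d\times m}$ (demands) and ${\bf v}'_k\in\mathbb{F}_q^{d\times m'}$ (side-information), $k=1,\dots,K$. A coding scheme consists of a batch size $L\ge 1$, a finite alphabet $\mathcal{S}$, an encoder $\Phi:\mathbb{F}_q^{d\times L}\to\mathcal{S}$ and decoders $\Psi_k:\mathcal{S}\times\mathbb{F}_q^{L\times m'}\to\mathbb{F}_q^{L\times m}$, $k=1,\dots,K$ (arbitrary maps, not necessarily linear); it is achievable for the instance if $\Psi_k(\Phi({\bf x}),{\bf x}^T{\bf v}'_k)={\bf x}^T{\bf v}_k$ for all ${\bf x}\in\mathbb{F}_q^{d\times L}$ and all $k$, and its broadcast cost is $\log_q|\mathcal{S}|/L$. The optimal broadcast cost $\Delta^*(\Lambda)$ of an instance $\Lambda$ is the infimum of the broadcast costs of its achievable schemes. Let $\Lambda_n$ be uniformly distributed on the set of all instances over $\mathbb{F}_{p^n}$ with the given $K,d,m,m'$. The generic optimal broadcast cost is said to exist and to equal $\Delta_g\in\mathbb{R}$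 if $\Delta^*(\Lambda_n)\to\Delta_g$ in probability, i.e. $\lim_{n\to\infty}\Pr\big(|\Delta^*(\Lambda_n)-\Delta_g|<\varepsilon\big)=1$ for every $\varepsilon>0$. **Theorem.** Suppose $K\ge d/\gcd(d,m+m')$ (a condition that is read as vacuous when $d=0$). Then in each of the following cases the generic optimal broadcast cost exists, and $$\Delta_g=\begin{cases}0, & d\le m';\\ d-m', & m'\le d\le m+m';\\ \dfrac{dm}{m+m'}, & m+m'<d\le K(m+m').\end{cases}$$ -/

import Mathlib

open Filter Topology

namespace LCBC

/-- A symmetric linear computation broadcast instance over `F` with `K` users, `d`-dimensional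
data, `m`-dimensional demands and `m'`-dimensional side-information: the coefficient matrices
`v k` (demands) and `v' k` (side-information). No rank condition is imposed. -/
abbrev Inst (F : Type) (K d m m' : ℕ) : Type :=
  (Fin K → Matrix (Fin d) (Fin m) F) × (Fin K → Matrix (Fin d) (Fin m') F)

/-- The demand matrix of user `k`. -/
abbrev Inst.v {F : Type} {K d m m' : ℕ} (Λ : Inst F K d m m') (k : Fin K) :
    Matrix (Fin d) (Fin m) F := Λ.1 k

/-- The side-information matrix of user `k`. -/
abbrev Inst.v' {F : Type} {K d m m' : ℕ} (Λ : Inst F K d m m') (k : Fin K) :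
    Matrix (Fin d) (Fin m') F := Λ.2 k

/-- A coding scheme: a batch size `L ≥ 1`, a finite alphabet `S`, an arbitrary (not necessarily
linear) encoder of the `d × L` data matrix, and an arbitrary decoder for each user. -/
structure Scheme (F : Type) (K d m m' : ℕ) where
  L : ℕ
  L_pos : 0 < L
  S : Type
  finite_S : Finite S
  enc : Matrix (Fin d) (Fin L) F → S
  dec : Fin K → S → Matrix (Fin L) (Fin m') F → Matrix (Fin L) (Fin m) F

/-- The scheme lets every user `k` compute `xᵀ vₖ` from the broadcast symbol and its
side-information `xᵀ v'ₖ`, for every realization `x` of the data. -/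
def Scheme.Achieves {F : Type} [Field F] {K d m m' : ℕ} (σ : Scheme F K d m m')
    (Λ : Inst F K d m m') : Prop :=
  ∀ (x : Matrix (Fin d) (Fin σ.L) F) (k : Fin K),
    σ.dec k (σ.enc x) (x.transpose * Λ.v' k) = x.transpose * Λ.v k

/-- The broadcast cost `log_q |S| / L`, where `q = |F|`. -/
noncomputable def Scheme.cost {F : Type} {K d m m' : ℕ} (σ : Scheme F K d m m') : ℝ :=
  Real.logb (Nat.card F) (Nat.card σ.S) / σ.L

/-- The optimal broadcast cost `Δ*(Λ)`: the infimum of the costs of the achievable schemes. -/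
noncomputable def optCost {F : Type} [Field F] {K d m m' : ℕ} (Λ : Inst F K d m m') : ℝ :=
  sInf {Δ : ℝ | ∃ σ : Scheme F K d m m', σ.Achieves Λ ∧ σ.cost = Δ}

/-- The probability of the event `E` for an instance drawn uniformly at random among all
instances over the field with `p ^ n` elements. -/
noncomputable def prob (p : ℕ) [Fact p.Prime] (n K d m m' : ℕ)
    (E : Inst (GaloisField p n) K d m m' → Prop) : ℝ :=
  (Nat.card {Λ : Inst (GaloisField p n) K d m m' // E Λ} : ℝ) /
    (Nat.card (Inst (GaloisField p n) K d m m') : ℝ)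

/-- The generic optimal broadcast cost exists and equals `Δg`: as `n → ∞`, the optimal cost of a
uniformly random instance over the field with `p ^ n` elements converges to `Δg` in
probability. -/
def IsGenericCost (p : ℕ) [Fact p.Prime] (K d m m' : ℕ) (Δg : ℝ) : Prop :=
  ∀ ε : ℝ, 0 < ε →
    Tendsto (fun n : ℕ => prob p n K d m m' (fun Λ => |optCost Λ - Δg| < ε)) atTop (𝓝 1)

end LCBC

/-!
Converse. For a scheme with uniformly distributed data `x`, the function `U ↦ H(xᵀ U | enc x)` of
subspaces `U` of `F ^ d` is submodular; it is at most `m' L log q` on the column space of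
`[v k, v' k]`, because the side-information determines the demand, and at least
`(d - cost) L log q` on the whole space. If the column space of a single user is everything, this
gives `cost ≥ d - m'`. If `N (m + m') = t d` and the column spaces are in general position,
replacing two of them by their sum and intersection turns `N` of them into `t` copies of the whole
space, and submodularity gives `cost ≥ d m / (m + m')`.

Achievability. If `d ≤ m + m'`, broadcasting `d - m'` coordinates is almost always enough. If
`m + m' < d`, regard `F` as a vector space over the prime field and broadcast the class of each
data symbol modulo a subspace `Z` that all coefficients map into a subspace `Z₀` of almost the same
codimension: such a pair consists of the trace-orthogonals of alignment spaces spanned by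
monomials in the coefficients. What remains unknown to a user lies in `Z₀ ^ (m + m')`. Adding to
the side-information random combinations of the demands affects neither `Z₀` nor the distribution
of the instance, and a union bound shows that then every user can almost always decode, provided
that the codimension of `Z₀` is a fraction larger than `m / (m + m')` of the dimension of `F`.
-/

namespace LCBC

open scoped BigOperators Matrix

section Entropy

variable {Ω : Type*} [Fintype Ω]

open Classical in
/-- The number of elements of the class of `ω`. -/
noncomputable def classCard (r : Setoid Ω) (ω : Ω) : ℕ :=
  (Finset.univ.filter fun y => r y ω).card

/-- The Shannon entropy, in nats, of the class of a uniformly distributed point of `Ω`. A random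
variable on `Ω` is represented by its kernel, so that joint variables are infima of setoids. -/
noncomputable def ent (r : Setoid Ω) : ℝ :=
  𝔼 ω, Real.log (Fintype.card Ω / classCard r ω)

lemma classCard_pos (r : Setoid Ω) (ω : Ω) : 0 < classCard r ω := by
  classical
  exact Finset.card_pos.mpr ⟨ω, Finset.mem_filter.mpr ⟨Finset.mem_univ ω, r.refl ω⟩⟩

lemma cast_classCard_pos (r : Setoid Ω) (ω : Ω) : (0 : ℝ) < classCard r ω :=
  Nat.cast_pos.mpr (classCard_pos r ω)

lemma classCard_congr (r : Setoid Ω) {a b : Ω} (h : r a b) : classCard r a = classCard r b := by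
  classical
  exact congrArg Finset.card (Finset.filter_congr fun _ _ =>
    ⟨fun hy => r.trans hy h, fun hy => r.trans hy (r.symm h)⟩)

lemma sum_inv_classCard_le_one (r : Setoid Ω) {s : Finset Ω} (hs : ∀ x ∈ s, ∀ y ∈ s, r x y) :
    ∑ x ∈ s, (classCard r x : ℝ)⁻¹ ≤ 1 := by
  classical
  obtain rfl | ⟨a, ha⟩ := s.eq_empty_or_nonempty
  · simp
  · have hcard : s.card ≤ classCard r a :=
      Finset.card_le_card fun x hx => Finset.mem_filter.mpr ⟨Finset.mem_univ x, hs x hx a ha⟩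
    calc ∑ x ∈ s, (classCard r x : ℝ)⁻¹ = s.card * (classCard r a : ℝ)⁻¹ := by
          rw [← nsmul_eq_mul]
          exact Finset.sum_eq_card_nsmul fun x hx => by rw [classCard_congr r (hs x hx a ha)]
      _ ≤ 1 := mul_inv_le_one_of_le₀ (by exact_mod_cast hcard) (Nat.cast_nonneg _)

open Classical in
lemma cast_classCard_eq_sum (r : Setoid Ω) (ω : Ω) :
    (classCard r ω : ℝ) = ∑ y, if r y ω then 1 else 0 := by
  simp [classCard]

open Classical in
lemma sum_inv_classCard_mul_inv_classCard_le {r s t : Setoid Ω} (hr : r ≤ t) (hs : s ≤ t)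
    (a b : Ω) :
    ∑ ω with r a ω ∧ s b ω, (classCard (r ⊓ s) ω : ℝ)⁻¹ * (classCard t ω : ℝ)⁻¹ ≤
      if t b a then (classCard t b : ℝ)⁻¹ else 0 := by
  split_ifs with hba
  · calc _ = (∑ ω with r a ω ∧ s b ω, (classCard (r ⊓ s) ω : ℝ)⁻¹) * (classCard t b : ℝ)⁻¹ := by
          rw [Finset.sum_mul]
          refine Finset.sum_congr rfl fun ω hω => ?_
          rw [classCard_congr t (hs (Finset.mem_filter.mp hω).2.2)]
      _ ≤ (classCard t b : ℝ)⁻¹ := by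
          refine mul_le_of_le_one_left (by positivity) (sum_inv_classCard_le_one _ ?_)
          simp only [Finset.mem_filter_univ]
          exact fun x hx y hy => ⟨r.trans (r.symm hx.1) hy.1, s.trans (s.symm hx.2) hy.2⟩
  · refine (Finset.sum_eq_zero fun ω hω => absurd ?_ hba).le
    obtain ⟨ha, hb⟩ := (Finset.mem_filter.mp hω).2
    exact t.trans (hs hb) (t.symm (hr ha))

lemma sum_classCard_ratio_le {r s t : Setoid Ω} (hr : r ≤ t) (hs : s ≤ t) :
    ∑ ω, (classCard r ω * classCard s ω : ℝ) / (classCard (r ⊓ s) ω * classCard t ω) ≤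
      Fintype.card Ω := by
  classical
  calc ∑ ω, (classCard r ω * classCard s ω : ℝ) / (classCard (r ⊓ s) ω * classCard t ω)
      = ∑ ω, ∑ a, ∑ b, if r a ω ∧ s b ω then
          (classCard (r ⊓ s) ω : ℝ)⁻¹ * (classCard t ω : ℝ)⁻¹ else 0 := by
        refine Finset.sum_congr rfl fun ω _ => ?_
        rw [cast_classCard_eq_sum r, cast_classCard_eq_sum s, Finset.sum_mul_sum, div_eq_mul_inv,
          mul_inv, Finset.sum_mul]
        simp only [Finset.sum_mul, ite_and, ite_mul, one_mul, zero_mul]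
    _ = ∑ a, ∑ b, ∑ ω with r a ω ∧ s b ω,
          (classCard (r ⊓ s) ω : ℝ)⁻¹ * (classCard t ω : ℝ)⁻¹ := by
        simp only [Finset.sum_filter]
        rw [Finset.sum_comm]
        exact Finset.sum_congr rfl fun a _ => Finset.sum_comm
    _ ≤ ∑ a, ∑ b with t b a, (classCard t b : ℝ)⁻¹ := by
        simp only [Finset.sum_filter (p := fun b => t b _)]
        exact Finset.sum_le_sum fun a _ => Finset.sum_le_sum fun b _ =>
          sum_inv_classCard_mul_inv_classCard_le hr hs a b
    _ ≤ ∑ _a : Ω, 1 := by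
        refine Finset.sum_le_sum fun a _ => sum_inv_classCard_le_one t ?_
        simp only [Finset.mem_filter_univ]
        exact fun x hx y hy => t.trans hx (t.symm hy)
    _ = Fintype.card Ω := by simp

lemma expect_log_nonpos {f : Ω → ℝ} (hf : ∀ ω, 0 < f ω) (h : ∑ ω, f ω ≤ Fintype.card Ω) :
    𝔼 ω, Real.log (f ω) ≤ 0 := by
  rw [Fintype.expect_eq_sum_div_card]
  refine div_nonpos_of_nonpos_of_nonneg ?_ (Nat.cast_nonneg _)
  calc ∑ ω, Real.log (f ω) ≤ ∑ ω, (f ω - 1) :=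
        Finset.sum_le_sum fun ω _ => Real.log_le_sub_one_of_pos (hf ω)
    _ ≤ 0 := by simpa using h

lemma ent_inf_add_ent_le {r s t : Setoid Ω} (hr : r ≤ t) (hs : s ≤ t) :
    ent (r ⊓ s) + ent t ≤ ent r + ent s := by
  rw [← sub_nonpos]
  simp only [ent, ← Finset.expect_add_distrib, ← Finset.expect_sub_distrib]
  refine le_of_eq_of_le (Finset.expect_congr rfl fun ω _ => ?_) (expect_log_nonpos
    (f := fun ω => (classCard r ω * classCard s ω : ℝ) / (classCard (r ⊓ s) ω * classCard t ω))
    (fun ω => ?_) (sum_classCard_ratio_le hr hs))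
  all_goals
    have := cast_classCard_pos r ω
    have := cast_classCard_pos s ω
    have := cast_classCard_pos t ω
    have := cast_classCard_pos (r ⊓ s) ω
    have : (0 : ℝ) < Fintype.card Ω := Nat.cast_pos.mpr (Fintype.card_pos_iff.mpr ⟨ω⟩)
  · rw [← Real.log_mul (by positivity) (by positivity), ← Real.log_mul (by positivity)
      (by positivity), ← Real.log_div (by positivity) (by positivity)]
    congr 1
    field_simp
  · positivity

lemma ent_top : ent (⊤ : Setoid Ω) = 0 := by
  refine Finset.expect_eq_zero fun ω _ => ?_
  have : (Fintype.card Ω : ℝ) ≠ 0 := Nat.cast_ne_zero.mpr (Fintype.card_pos_iff.mpr ⟨ω⟩).ne'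
  simp [classCard, Setoid.top_def, this]

lemma ent_bot [Nonempty Ω] : ent (⊥ : Setoid Ω) = Real.log (Fintype.card Ω) := by
  classical
  have hclass (ω : Ω) : classCard ⊥ ω = 1 := Finset.card_eq_one.mpr ⟨ω, by ext; simp⟩
  simp [ent, hclass]

lemma ent_ker_le [Nonempty Ω] {β : Type*} [Fintype β] (g : Ω → β) :
    ent (Setoid.ker g) ≤ Real.log (Fintype.card β) := by
  classical
  have hβ : (0 : ℝ) < Fintype.card β :=
    Nat.cast_pos.mpr (Fintype.card_pos_iff.mpr (‹Nonempty Ω›.map g))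
  have : (0 : ℝ) < Fintype.card Ω := Nat.cast_pos.mpr Fintype.card_pos
  have hsum : ∑ ω, (classCard (Setoid.ker g) ω : ℝ)⁻¹ ≤ Fintype.card β := by
    rw [← Finset.sum_fiberwise Finset.univ g]
    refine (Finset.sum_le_sum fun b _ => sum_inv_classCard_le_one _ ?_).trans_eq (by simp)
    simp only [Finset.mem_filter_univ]
    exact fun x hx y hy => hx.trans hy.symm
  rw [← sub_nonpos, ent, ← Fintype.expect_const (ι := Ω) (Real.log (Fintype.card β)),
    ← Finset.expect_sub_distrib]
  refine le_of_eq_of_le (Finset.expect_congr rfl fun ω _ => ?_) (expect_log_nonpos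
    (f := fun ω => Fintype.card Ω / Fintype.card β * (classCard (Setoid.ker g) ω : ℝ)⁻¹)
    (fun ω => ?_) ?_)
  · have := cast_classCard_pos (Setoid.ker g) ω
    rw [← Real.log_div (by positivity) hβ.ne']
    congr 1
    field_simp
  · have := cast_classCard_pos (Setoid.ker g) ω
    positivity
  · rw [← Finset.mul_sum, div_mul_eq_mul_div, div_le_iff₀ hβ]
    gcongr

lemma ent_inf_ker_le [Nonempty Ω] {β : Type*} [Fintype β] (r : Setoid Ω) (g : Ω → β) :
    ent (r ⊓ Setoid.ker g) ≤ ent r + Real.log (Fintype.card β) := by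
  have hsub := ent_inf_add_ent_le (le_top : r ≤ ⊤) (le_top : Setoid.ker g ≤ ⊤)
  rw [ent_top, add_zero] at hsub
  exact hsub.trans (add_le_add_right (ent_ker_le g) _)

end Entropy

section GeneralPosition

variable {F V : Type*} [Field F] [AddCommGroup V] [Module F V]

open Classical in
/-- The running space obtained by uncrossing a sequence of subspaces one after the other. The two
subspaces are replaced by their sum and intersection; when one of these is `⊤` or `⊥` it is set
aside, and the other one is kept. -/
noncomputable def uncross (U : ℕ → Submodule F V) : ℕ → Submodule F V
  | 0 => ⊥
  | k + 1 => if uncross U k ⊓ U k = ⊥ then uncross U k ⊔ U k else uncross U k ⊓ U k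

lemma uncross_congr {U U' : ℕ → Submodule F V} {k : ℕ} (h : ∀ i < k, U i = U' i) :
    uncross U k = uncross U' k := by
  induction k with
  | zero => rfl
  | succ k ih => simp only [uncross, ih fun i hi => h i (by omega), h k (by omega)]

/-- General position of the first `N` subspaces of a sequence, as uncrossing needs it: each of them
has dimension `s`, and meets the running space trivially or spans with it the whole space. -/
def InGeneralPosition (U : ℕ → Submodule F V) (s N : ℕ) : Prop :=
  ∀ i < N, Module.finrank F (U i) = s ∧
    (uncross U i ⊓ U i = ⊥ ∨ uncross U i ⊔ U i = ⊤)

variable [FiniteDimensional F V] {U : ℕ → Submodule F V} {f : Submodule F V → ℝ} {s N : ℕ}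

lemma InGeneralPosition.exists_mul_add_uncross_le (hU : InGeneralPosition U s N)
    (hf : ∀ A B, f (A ⊔ B) + f (A ⊓ B) ≤ f A + f B) (hf₀ : f ⊥ = 0) {k : ℕ} (hk : k ≤ N) :
    ∃ j : ℕ, k * s = j * Module.finrank F V + Module.finrank F (uncross U k) ∧
      j * f ⊤ + f (uncross U k) ≤ ∑ i ∈ Finset.range k, f (U i) := by
  induction k with
  | zero => exact ⟨0, by rw [uncross, finrank_bot]; simp, by simp [uncross, hf₀]⟩
  | succ k ih =>
    obtain ⟨j, hdim, hsum⟩ := ih (by omega)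
    obtain ⟨hs, hpos⟩ := hU k (by omega)
    have hsupinf := Submodule.finrank_sup_add_finrank_inf_eq (uncross U k) (U k)
    have hsub := hf (uncross U k) (U k)
    rw [Finset.sum_range_succ]
    by_cases hbot : uncross U k ⊓ U k = ⊥
    · rw [hbot, finrank_bot] at hsupinf
      rw [hbot] at hsub
      rw [uncross, if_pos hbot]
      exact ⟨j, by linarith, by linarith⟩
    · rw [hpos.resolve_left hbot, finrank_top] at hsupinf
      rw [hpos.resolve_left hbot] at hsub
      rw [uncross, if_neg hbot]
      exact ⟨j + 1, by linarith, by push_cast; linarith⟩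

lemma InGeneralPosition.mul_le_sum {t : ℕ} (hU : InGeneralPosition U s N)
    (hV : 0 < Module.finrank F V) (hN : N * s = t * Module.finrank F V)
    (hf : ∀ A B, f (A ⊔ B) + f (A ⊓ B) ≤ f A + f B) (hf₀ : f ⊥ = 0) :
    t * f ⊤ ≤ ∑ i ∈ Finset.range N, f (U i) := by
  obtain ⟨j, hdim, hsum⟩ := hU.exists_mul_add_uncross_le hf hf₀ le_rfl
  have hle := Submodule.finrank_le (uncross U N)
  rw [hN] at hdim
  obtain hzero | hpos := (Module.finrank F (uncross U N)).eq_zero_or_pos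
  · obtain rfl : t = j := Nat.eq_of_mul_eq_mul_right hV (by omega)
    rwa [Submodule.finrank_eq_zero.mp hzero, hf₀, add_zero] at hsum
  · have hjt : j < t := lt_of_mul_lt_mul_right (a := Module.finrank F V) (by omega) (Nat.zero_le _)
    have hmul := Nat.mul_le_mul_right (Module.finrank F V) hjt
    rw [Nat.succ_mul] at hmul
    have hfull : Module.finrank F (uncross U N) = Module.finrank F V := by omega
    obtain rfl : t = j + 1 := Nat.eq_of_mul_eq_mul_right hV (by rw [Nat.succ_mul]; omega)
    rw [Submodule.eq_top_of_finrank_eq hfull] at hsum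
    push_cast
    linarith

end GeneralPosition

section ConditionalEntropy

lemma log_card_matrix {ι κ R : Type*} [Fintype ι] [Fintype κ] [DecidableEq ι] [DecidableEq κ]
    [Fintype R] : Real.log (Fintype.card (Matrix ι κ R)) =
      Fintype.card ι * Fintype.card κ * Real.log (Fintype.card R) := by
  simp [Fintype.card_congr (Matrix.of (m := ι) (n := κ) (α := R)).symm, mul_assoc]

variable {F : Type*} [Field F] {ι κ S : Type*} [Fintype ι]

/-- The kernel of `x ↦ (enc x, xᵀ U)`: the data are observed through their encoding and through the
linear functionals in `U`. -/
def obsRel (enc : Matrix ι κ F → S) (U : Submodule F (ι → F)) : Setoid (Matrix ι κ F) :=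
  Setoid.ker enc ⊓ Setoid.ker fun x (u : U) => xᵀ *ᵥ u.1

lemma obsRel_iff {enc : Matrix ι κ F → S} {U : Submodule F (ι → F)} {x y : Matrix ι κ F} :
    obsRel enc U x y ↔ enc x = enc y ∧ ∀ u ∈ U, xᵀ *ᵥ u = yᵀ *ᵥ u :=
  and_congr Iff.rfl (funext_iff.trans Subtype.forall)

lemma obsRel_anti (enc : Matrix ι κ F → S) {A B : Submodule F (ι → F)} (h : A ≤ B) :
    obsRel enc B ≤ obsRel enc A := fun _ _ hxy =>
  have ⟨henc, hB⟩ := obsRel_iff.mp hxy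
  obsRel_iff.mpr ⟨henc, fun u hu => hB u (h hu)⟩

lemma obsRel_sup (enc : Matrix ι κ F → S) (A B : Submodule F (ι → F)) :
    obsRel enc (A ⊔ B) = obsRel enc A ⊓ obsRel enc B := by
  refine le_antisymm (le_inf (obsRel_anti enc le_sup_left) (obsRel_anti enc le_sup_right)) ?_
  rintro x y ⟨hxyA, hxyB⟩
  obtain ⟨henc, hA⟩ := obsRel_iff.mp hxyA
  obtain ⟨-, hB⟩ := obsRel_iff.mp hxyB
  refine obsRel_iff.mpr ⟨henc, fun u hu => ?_⟩
  obtain ⟨a, ha, b, hb, rfl⟩ := Submodule.mem_sup.mp hu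
  rw [Matrix.mulVec_add, Matrix.mulVec_add, hA a ha, hB b hb]

lemma obsRel_bot (enc : Matrix ι κ F → S) :
    obsRel enc (⊥ : Submodule F (ι → F)) = Setoid.ker enc := by
  ext x y
  simp [obsRel_iff, Setoid.ker_def]

lemma obsRel_top (enc : Matrix ι κ F → S) : obsRel enc (⊤ : Submodule F (ι → F)) = ⊥ := by
  classical
  exact eq_bot_iff.mpr fun _ _ hxy => Matrix.transpose_injective <|
    Matrix.ext_of_mulVec_single fun _ => (obsRel_iff.mp hxy).2 _ Submodule.mem_top

lemma obsRel_range_mulVecLin {ν : Type*} [Fintype ν] (enc : Matrix ι κ F → S) (M : Matrix ι ν F) :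
    obsRel enc (LinearMap.range M.mulVecLin) =
      Setoid.ker enc ⊓ Setoid.ker fun x => xᵀ * M := by
  classical
  ext x y
  rw [obsRel_iff, Setoid.inf_def, Pi.inf_apply, Pi.inf_apply]
  refine and_congr Iff.rfl ⟨fun h => Matrix.ext_of_mulVec_single fun j => ?_, ?_⟩
  · rw [← Matrix.mulVec_mulVec, ← Matrix.mulVec_mulVec]
    exact h _ ⟨Pi.single j 1, rfl⟩
  · rintro (h : xᵀ * M = yᵀ * M) _ ⟨c, rfl⟩
    rw [Matrix.mulVecLin_apply, Matrix.mulVec_mulVec, Matrix.mulVec_mulVec, h]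

variable [Fintype κ] [DecidableEq ι] [DecidableEq κ] [Fintype F]

/-- The entropy `H(xᵀ U | enc x)`, in nats, for uniformly distributed data `x`. -/
noncomputable def condEnt (enc : Matrix ι κ F → S) (U : Submodule F (ι → F)) : ℝ :=
  ent (obsRel enc U) - ent (Setoid.ker enc)

lemma condEnt_bot (enc : Matrix ι κ F → S) : condEnt enc ⊥ = 0 := by
  rw [condEnt, obsRel_bot, sub_self]

lemma condEnt_sup_add_condEnt_inf_le (enc : Matrix ι κ F → S) (A B : Submodule F (ι → F)) :
    condEnt enc (A ⊔ B) + condEnt enc (A ⊓ B) ≤ condEnt enc A + condEnt enc B := by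
  have := ent_inf_add_ent_le (obsRel_anti enc (inf_le_left : A ⊓ B ≤ A))
    (obsRel_anti enc (inf_le_right : A ⊓ B ≤ B))
  simp only [condEnt, obsRel_sup]
  linarith

lemma le_condEnt_top [Fintype S] (enc : Matrix ι κ F → S) :
    Fintype.card ι * Fintype.card κ * Real.log (Fintype.card F) - Real.log (Fintype.card S) ≤
      condEnt enc ⊤ := by
  rw [condEnt, obsRel_top, ent_bot, log_card_matrix]
  exact sub_le_sub_left (ent_ker_le enc) _

end ConditionalEntropy

section Converse

variable {F : Type} [Field F] {K d m m' : ℕ}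

/-- The matrix `[v k, v' k]` of everything user `k` knows in the end. -/
def userMatrix (Λ : Inst F K d m m') (k : Fin K) : Matrix (Fin d) (Fin m ⊕ Fin m') F :=
  Matrix.fromCols (Λ.v k) (Λ.v' k)

/-- The column space of `userMatrix Λ k`. -/
def userSpace (Λ : Inst F K d m m') (k : Fin K) : Submodule F (Fin d → F) :=
  LinearMap.range (userMatrix Λ k).mulVecLin

/-- The spaces of the users as an infinite sequence, extended by `⊥`, to which `uncross` applies. -/
def userSpaceSeq (Λ : Inst F K d m m') (i : ℕ) : Submodule F (Fin d → F) :=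
  if h : i < K then userSpace Λ ⟨i, h⟩ else ⊥

variable {σ : Scheme F K d m m'} {Λ : Inst F K d m m'}

lemma Scheme.Achieves.obsRel_userSpace (h : σ.Achieves Λ) (k : Fin K) :
    obsRel σ.enc (userSpace Λ k) = Setoid.ker σ.enc ⊓ Setoid.ker fun x => xᵀ * Λ.v' k := by
  rw [userSpace, obsRel_range_mulVecLin]
  ext x y
  refine and_congr_right fun (henc : σ.enc x = σ.enc y) => ?_
  simp only [Setoid.ker_def, userMatrix, Matrix.mul_fromCols, Matrix.fromCols_inj.eq_iff,
    and_iff_right_iff_imp]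
  intro hside
  rw [← h x k, ← h y k, henc, hside]

lemma Scheme.Achieves.condEnt_userSpace_le [Fintype F] (h : σ.Achieves Λ) (k : Fin K) :
    condEnt σ.enc (userSpace Λ k) ≤ m' * (σ.L * Real.log (Fintype.card F)) := by
  rw [condEnt, h.obsRel_userSpace, sub_le_iff_le_add']
  refine (ent_inf_ker_le _ _).trans_eq ?_
  rw [log_card_matrix, Fintype.card_fin, Fintype.card_fin]
  ring

variable [Finite F]

lemma Scheme.cost_nonneg (σ : Scheme F K d m m') : 0 ≤ σ.cost := by
  have := σ.finite_S
  have : Nonempty σ.S := ⟨σ.enc 0⟩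
  exact div_nonneg (Real.logb_nonneg (Nat.one_lt_cast.mpr Finite.one_lt_card)
    (Nat.one_le_cast.mpr Nat.card_pos)) (Nat.cast_nonneg _)

lemma Scheme.L_mul_log_card_pos (σ : Scheme F K d m m') : 0 < σ.L * Real.log (Nat.card F) :=
  mul_pos (Nat.cast_pos.mpr σ.L_pos) (Real.log_pos (Nat.one_lt_cast.mpr Finite.one_lt_card))

lemma Scheme.log_card_eq (σ : Scheme F K d m m') :
    Real.log (Nat.card σ.S) = σ.cost * (σ.L * Real.log (Nat.card F)) := by
  have hpos := σ.L_mul_log_card_pos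
  have hL := left_ne_zero_of_mul hpos.ne'
  have hq := right_ne_zero_of_mul hpos.ne'
  rw [Scheme.cost, Real.logb]
  field_simp

lemma Scheme.sub_cost_mul_le_condEnt_top [Fintype F] (σ : Scheme F K d m m') :
    (d - σ.cost) * (σ.L * Real.log (Fintype.card F)) ≤ condEnt σ.enc ⊤ := by
  have := σ.finite_S
  have := Fintype.ofFinite σ.S
  refine le_of_eq_of_le ?_ (le_condEnt_top σ.enc)
  rw [← Nat.card_eq_fintype_card (α := σ.S), σ.log_card_eq, Fintype.card_fin, Fintype.card_fin,
    Nat.card_eq_fintype_card]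
  ring

lemma Scheme.Achieves.le_cost_of_inGeneralPosition (h : σ.Achieves Λ) {N t : ℕ} (hNK : N ≤ K)
    (hd : 0 < d) (ht : 0 < t) (hN : N * (m + m') = t * d)
    (hg : InGeneralPosition (userSpaceSeq Λ) (m + m') N) :
    (d * m : ℝ) / (m + m') ≤ σ.cost := by
  have := Fintype.ofFinite F
  have hL := σ.L_mul_log_card_pos
  rw [Nat.card_eq_fintype_card] at hL
  have hsum : ∑ i ∈ Finset.range N, condEnt σ.enc (userSpaceSeq Λ i) ≤
      N * (m' * (σ.L * Real.log (Fintype.card F))) := by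
    refine (Finset.sum_le_card_nsmul _ _ _ fun i hi => ?_).trans_eq
      (by rw [Finset.card_range, nsmul_eq_mul])
    rw [userSpaceSeq, dif_pos ((Finset.mem_range.mp hi).trans_le hNK)]
    exact h.condEnt_userSpace_le _
  have hshearer := (mul_le_mul_of_nonneg_left σ.sub_cost_mul_le_condEnt_top t.cast_nonneg).trans
    ((hg.mul_le_sum (by simpa using hd) (by simpa using hN) (condEnt_sup_add_condEnt_inf_le σ.enc)
      (condEnt_bot σ.enc)).trans hsum)
  have hcost : (t : ℝ) * (d - σ.cost) ≤ N * m' :=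
    le_of_mul_le_mul_right (by linarith only [hshearer]) hL
  have hN' : (N : ℝ) * (m + m') = t * d := by exact_mod_cast hN
  refine div_le_of_le_mul₀ (by positivity) σ.cost_nonneg ?_
  refine le_of_mul_le_mul_left ?_ (Nat.cast_pos.mpr ht : (0 : ℝ) < t)
  calc (t * (d * m) : ℝ) = N * m * (m + m') := by rw [← mul_assoc, ← hN']; ring
    _ ≤ t * σ.cost * (m + m') := mul_le_mul_of_nonneg_right (by linarith) (by positivity)
    _ = t * (σ.cost * (m + m')) := by ring

lemma Scheme.Achieves.le_cost_of_userSpace_eq_top (h : σ.Achieves Λ) {k : Fin K}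
    (hk : userSpace Λ k = ⊤) : (d : ℝ) - m' ≤ σ.cost := by
  have := Fintype.ofFinite F
  have hL := σ.L_mul_log_card_pos
  rw [Nat.card_eq_fintype_card] at hL
  have hle := h.condEnt_userSpace_le k
  rw [hk] at hle
  linarith [le_of_mul_le_mul_right (σ.sub_cost_mul_le_condEnt_top.trans hle) hL]

lemma Scheme.Achieves.optCost_le (h : σ.Achieves Λ) : optCost Λ ≤ σ.cost :=
  csInf_le ⟨0, by rintro _ ⟨τ, -, rfl⟩; exact τ.cost_nonneg⟩ ⟨σ, h, rfl⟩

end Converse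

section Achievability

variable {F : Type} [Field F] {K d m m' : ℕ} {S : Type} [AddCommGroup S] [Finite S]

/-- The scheme of batch size `1` that broadcasts `φ x`. A decoder inverts `x ↦ (φ x, xᵀ v' k)` as
far as it can; off the range of this map its value is irrelevant. -/
noncomputable def homScheme (φ : (Fin d → F) →+ S) (Λ : Inst F K d m m') : Scheme F K d m m' where
  L := 1
  L_pos := one_pos
  S := S
  finite_S := inferInstance
  enc x := φ (x.col 0)
  dec k c y := Function.extend
    (fun x : Matrix (Fin d) (Fin 1) F => (φ (x.col 0), xᵀ * Λ.v' k)) (fun x => xᵀ * Λ.v k) 0 (c, y)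

lemma homScheme_achieves {φ : (Fin d → F) →+ S} {Λ : Inst F K d m m'}
    (h : ∀ k x, φ x = 0 → x ᵥ* Λ.v' k = 0 → x ᵥ* Λ.v k = 0) : (homScheme φ Λ).Achieves Λ := by
  intro x k
  refine Function.FactorsThrough.extend_apply (g := fun x : Matrix (Fin d) (Fin 1) F => xᵀ * Λ.v k)
    (fun x y hxy => ?_) _ x
  have row {n : ℕ} (V : Matrix (Fin d) (Fin n) F) :
      xᵀ * V = yᵀ * V ↔ (x.col 0 - y.col 0) ᵥ* V = 0 := by
    rw [Matrix.sub_vecMul, sub_eq_zero]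
    exact ⟨fun h => congrFun h 0, fun h => funext fun i => by rwa [Subsingleton.elim i 0]⟩
  obtain ⟨hφ, hside⟩ := Prod.mk.inj hxy
  exact (row _).mpr (h k _ (by rw [map_sub, hφ, sub_self]) ((row _).mp hside))

variable [Finite F] {Λ : Inst F K d m m'}

lemma logb_natCard_fin_fun (n : ℕ) : Real.logb (Nat.card F) (Nat.card (Fin n → F)) = n := by
  have hq : (1 : ℝ) < Nat.card F := by exact_mod_cast Finite.one_lt_card (α := F)
  rw [Nat.card_fun, Nat.card_eq_fintype_card (α := Fin n), Fintype.card_fin, Nat.cast_pow,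
    Real.logb_pow, Real.logb_self_eq_one hq, mul_one]

lemma optCost_le_logb_card (φ : (Fin d → F) →+ S)
    (h : ∀ k x, φ x = 0 → x ᵥ* Λ.v' k = 0 → x ᵥ* Λ.v k = 0) :
    optCost Λ ≤ Real.logb (Nat.card F) (Nat.card S) :=
  (homScheme_achieves h).optCost_le.trans_eq (by simp [Scheme.cost, homScheme])

lemma le_optCost {c : ℝ} (h : ∀ σ : Scheme F K d m m', σ.Achieves Λ → c ≤ σ.cost) :
    c ≤ optCost Λ := by
  have hid : (homScheme (AddMonoidHom.id (Fin d → F)) Λ).Achieves Λ :=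
    homScheme_achieves fun k x hx _ => by simp [show x = 0 from hx]
  refine le_csInf ⟨_, _, hid, rfl⟩ ?_
  rintro _ ⟨σ, hσ, rfl⟩
  exact h σ hσ

lemma optCost_nonneg (Λ : Inst F K d m m') : 0 ≤ optCost Λ :=
  le_optCost fun σ _ => σ.cost_nonneg

lemma optCost_le (Λ : Inst F K d m m') : optCost Λ ≤ d := by
  refine (optCost_le_logb_card (AddMonoidHom.id (Fin d → F)) fun k x hx _ => ?_).trans_eq
    (logb_natCard_fin_fun d)
  simp [show x = 0 from hx]

end Achievability

section Tiling

variable {k F κ : Type*} [Field k] [Finite k] [Field F] [Algebra k F] [FiniteDimensional k F]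

lemma exists_forall_mul_notMem {W E : Submodule k F}
    (h : Module.finrank k W + Module.finrank k E ≤ Module.finrank k F) :
    ∃ z : F, ∀ w ∈ W, w ≠ 0 → z * w ∉ E := by
  have := Module.finite_of_finite k (M := F)
  by_contra! hcover
  have hsurj : Function.Surjective fun a : {w : W // w ≠ 0} × E => a.2.1 / a.1.1.1 := fun z =>
    have ⟨w, hw, hw0, hz⟩ := hcover z
    ⟨(⟨⟨w, hw⟩, fun h => hw0 (congrArg Subtype.val h)⟩, ⟨z * w, hz⟩), mul_div_cancel_right₀ z hw0⟩
  have hcard := Nat.card_le_card_of_surjective _ hsurj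
  have hlt : Nat.card {w : W // w ≠ 0} < Nat.card W := Finite.card_subtype_lt (x := 0) (by simp)
  have hle : Nat.card W * Nat.card E ≤ Nat.card F := by
    rw [Module.natCard_eq_pow_finrank (K := k) (V := W),
      Module.natCard_eq_pow_finrank (K := k) (V := E),
      Module.natCard_eq_pow_finrank (K := k) (V := F), ← pow_add]
    exact Nat.pow_le_pow_right Nat.card_pos h
  rw [Nat.card_prod] at hcard
  exact (Nat.mul_lt_mul_of_pos_right hlt Nat.card_pos).not_ge (hle.trans hcard)

lemma exists_disjoint_map_mulLeft {W E : Submodule k F}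
    (h : Module.finrank k W + Module.finrank k E ≤ Module.finrank k F) :
    ∃ z : F, z ≠ 0 ∧ Disjoint E (W.map (LinearMap.mulLeft k z)) := by
  obtain rfl | hW := eq_or_ne W ⊥
  · exact ⟨1, one_ne_zero, by simp⟩
  obtain ⟨w₀, hw₀, hne⟩ := W.exists_mem_ne_zero_of_ne_bot hW
  obtain ⟨z, hz⟩ := exists_forall_mul_notMem h
  refine ⟨z, ?_, Submodule.disjoint_def.mpr ?_⟩
  · rintro rfl
    exact hz w₀ hw₀ hne (by simp)
  · rintro _ hx ⟨w, hw, rfl⟩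
    by_contra hzw
    exact hz w hw (right_ne_zero_of_mul hzw) hx

lemma exists_tiling {e : κ → F} {W W' : Submodule k F} (he : ∀ i, ∀ w ∈ W, e i * w ∈ W') {r : ℕ}
    (hr : r * Module.finrank k W ≤ Module.finrank k F) :
    ∃ E E' : Submodule k F, Module.finrank k E = r * Module.finrank k W ∧
      Module.finrank k E' ≤ r * Module.finrank k W' ∧ ∀ i, ∀ w ∈ E, e i * w ∈ E' := by
  induction r with
  | zero => exact ⟨⊥, ⊥, by simp, by simp, by simp⟩
  | succ r ih =>
    rw [add_mul, one_mul] at hr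
    obtain ⟨E, E', hE, hE', heE⟩ := ih (by omega)
    obtain ⟨z, hz0, hz⟩ := exists_disjoint_map_mulLeft (W := W) (E := E) (by omega)
    have hinj : Function.Injective (LinearMap.mulLeft k z) := mul_right_injective₀ hz0
    refine ⟨E ⊔ W.map (LinearMap.mulLeft k z), E' ⊔ W'.map (LinearMap.mulLeft k z), ?_, ?_, ?_⟩
    · have hsup := Submodule.finrank_sup_add_finrank_inf_eq E (W.map (LinearMap.mulLeft k z))
      rw [hz.eq_bot, finrank_bot, ← (Submodule.equivMapOfInjective _ hinj W).finrank_eq] at hsup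
      linarith
    · have hsup := Submodule.finrank_add_le_finrank_add_finrank E' (W'.map (LinearMap.mulLeft k z))
      have hmap := Submodule.finrank_map_le (LinearMap.mulLeft k z) W'
      linarith
    · intro i x hx
      obtain ⟨a, ha, _, ⟨w, hw, rfl⟩, rfl⟩ := Submodule.mem_sup.mp hx
      rw [LinearMap.mulLeft_apply, mul_add, mul_left_comm]
      exact Submodule.add_mem_sup (heE i a ha) ⟨e i * w, he i w hw, rfl⟩

end Tiling

section Alignment

/-- The span of the monomials in the `e i` with all exponents less than `η`: the alignment spaces
of Cadambe and Jafar. -/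
def monomialSpan (k : Type*) {F ι : Type*} [Field k] [Field F] [Algebra k F] [Fintype ι]
    (e : ι → F) (η : ℕ) : Submodule k F :=
  Submodule.span k (Set.range fun a : ι → Fin η => ∏ i, e i ^ (a i : ℕ))

variable {k F ι : Type*} [Field k] [Field F] [Algebra k F] [Fintype ι]

lemma one_mem_monomialSpan (e : ι → F) (η : ℕ) : (1 : F) ∈ monomialSpan k e (η + 1) :=
  Submodule.subset_span ⟨fun _ => 0, by simp⟩

lemma finrank_monomialSpan_le (e : ι → F) (η : ℕ) :
    Module.finrank k (monomialSpan k e η) ≤ η ^ Fintype.card ι := by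
  classical
  exact (finrank_range_le_card _).trans (by simp)

lemma mul_mem_monomialSpan (e : ι → F) {η : ℕ} (i : ι) {w : F} (hw : w ∈ monomialSpan k e η) :
    e i * w ∈ monomialSpan k e (η + 1) := by
  classical
  suffices h : monomialSpan k e η ≤ (monomialSpan k e (η + 1)).comap (LinearMap.mulLeft k (e i))
    from h hw
  refine Submodule.span_le.mpr ?_
  rintro _ ⟨a, rfl⟩
  have hlt (j : ι) : a j + (Pi.single i 1 : ι → ℕ) j < η + 1 := by
    have := (a j).isLt
    rw [Pi.single_apply]
    split_ifs <;> omega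
  have hsingle : ∏ j, e j ^ (Pi.single i 1 : ι → ℕ) j = e i := by
    rw [Fintype.prod_eq_single i fun j hj => by rw [Pi.single_eq_of_ne hj, pow_zero],
      Pi.single_eq_same, pow_one]
  refine Submodule.subset_span ⟨fun j => ⟨_, hlt j⟩, ?_⟩
  simp only [LinearMap.mulLeft_apply, pow_add, Finset.prod_mul_distrib, hsingle, mul_comm]

lemma exists_pow_lt (T : ℕ) {ε : ℝ} (hε : 0 < ε) :
    ∃ N : ℕ, ((N + 1 : ℕ) : ℝ) ^ T < (1 + ε) ^ N := by
  have hlim := (tendsto_pow_const_div_const_pow_of_one_lt T (lt_add_of_pos_right 1 hε)).comp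
    (tendsto_add_atTop_nat 1)
  obtain ⟨N, hN⟩ := (hlim.eventually_lt_const (show (0 : ℝ) < (1 + ε)⁻¹ by positivity)).exists
  rw [Function.comp_apply, div_lt_iff₀ (by positivity), pow_succ', inv_mul_cancel_left₀
    (by positivity)] at hN
  exact ⟨N, hN⟩

lemma exists_le_mul_of_lt_pow {f : ℕ → ℝ} {c : ℝ} {N : ℕ} (hc : 0 ≤ c) (h₀ : 1 ≤ f 0)
    (hN : f N < c ^ N) : ∃ n < N, f (n + 1) ≤ c * f n := by
  by_contra! hgrow
  suffices h : ∀ n ≤ N, c ^ n ≤ f n from hN.not_ge (h N le_rfl)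
  intro n hn
  induction n with
  | zero => simpa using h₀
  | succ n ih =>
    calc c ^ (n + 1) = c * c ^ n := pow_succ' c n
      _ ≤ c * f n := mul_le_mul_of_nonneg_left (ih (by omega)) hc
      _ ≤ f (n + 1) := (hgrow n hn).le

variable [FiniteDimensional k F] {ε : ℝ} {N : ℕ}

lemma exists_nearly_invariant (e : ι → F) (hε : 0 < ε)
    (hN : ((N + 1 : ℕ) : ℝ) ^ Fintype.card ι < (1 + ε) ^ N) :
    ∃ W W' : Submodule k F, 0 < Module.finrank k W ∧
      Module.finrank k W ≤ N ^ Fintype.card ι ∧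
      (Module.finrank k W' : ℝ) ≤ (1 + ε) * Module.finrank k W ∧
      ∀ i, ∀ w ∈ W, e i * w ∈ W' := by
  have hpos (η : ℕ) : 0 < Module.finrank k (monomialSpan k e (η + 1)) :=
    Module.finrank_pos_iff_exists_ne_zero.mpr
      ⟨⟨1, one_mem_monomialSpan e η⟩, fun h => one_ne_zero (congrArg Subtype.val h)⟩
  have hbound : (Module.finrank k (monomialSpan k e (N + 1)) : ℝ) < (1 + ε) ^ N :=
    lt_of_le_of_lt (by exact_mod_cast finrank_monomialSpan_le e (N + 1)) hN
  obtain ⟨η, hη, hgrow⟩ := exists_le_mul_of_lt_pow (by positivity)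
    (f := fun η => (Module.finrank k (monomialSpan k e (η + 1)) : ℝ))
    (Nat.one_le_cast.mpr (hpos 0)) hbound
  exact ⟨monomialSpan k e (η + 1), monomialSpan k e (η + 2), hpos η,
    (finrank_monomialSpan_le e _).trans (Nat.pow_le_pow_left hη _), hgrow,
    fun i _ => mul_mem_monomialSpan e i⟩

/- Multiplication by `e i` is self-adjoint for the trace form, so it maps the orthogonal space of
`E'` into that of `E` as soon as it maps `E` into `E'`. -/
lemma exists_aligned [Finite k] (e : ι → F) (hε : 0 < ε)
    (hN : ((N + 1 : ℕ) : ℝ) ^ Fintype.card ι < (1 + ε) ^ N) {D : ℕ}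
    (hD : D ≤ Module.finrank k F) :
    ∃ Z Z₀ : Submodule k F, Module.finrank k (F ⧸ Z₀) ≤ D ∧
      D ≤ Module.finrank k (F ⧸ Z₀) + N ^ Fintype.card ι ∧
      (Module.finrank k (F ⧸ Z) : ℝ) ≤ (1 + ε) * Module.finrank k (F ⧸ Z₀) ∧
      ∀ i, ∀ z ∈ Z, e i * z ∈ Z₀ := by
  have := Module.finite_of_finite k (M := F)
  obtain ⟨W, W', hW, hWN, hW', he⟩ := exists_nearly_invariant (k := k) e hε hN
  have hdiv := Nat.div_mul_le_self D (Module.finrank k W)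
  have hmod := Nat.lt_div_mul_add (a := D) hW
  obtain ⟨E, E', hE, hE', heE⟩ := exists_tiling he (hdiv.trans hD)
  have hcodim (U : Submodule k F) :
      Module.finrank k (F ⧸ (Algebra.traceForm k F).orthogonal U) = Module.finrank k U := by
    have horth := LinearMap.BilinForm.finrank_orthogonal (traceForm_nondegenerate k F) U
    have hquot := ((Algebra.traceForm k F).orthogonal U).finrank_quotient_add_finrank
    have hle := U.finrank_le
    omega
  refine ⟨(Algebra.traceForm k F).orthogonal E', (Algebra.traceForm k F).orthogonal E,
    ?_, ?_, ?_, ?_⟩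
  · rw [hcodim, hE]
    exact hdiv
  · rw [hcodim, hE]
    omega
  · rw [hcodim, hcodim, hE]
    calc (Module.finrank k E' : ℝ)
        ≤ (D / Module.finrank k W : ℕ) * Module.finrank k W' := by exact_mod_cast hE'
      _ ≤ (D / Module.finrank k W : ℕ) * ((1 + ε) * Module.finrank k W) := by gcongr
      _ = (1 + ε) * (D / Module.finrank k W * Module.finrank k W : ℕ) := by push_cast; ring
  · intro i z hz
    rw [LinearMap.BilinForm.mem_orthogonal_iff] at hz ⊢
    intro w hw
    have hzero := hz (e i * w) (heE i w hw)
    rw [Algebra.traceForm_apply] at hzero ⊢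
    rw [← hzero, mul_left_comm, mul_assoc]

end Alignment

section UniformProbability

variable {α β : Type*}

/-- The probability of the event `E` for a uniformly distributed element of `α`, as a ratio of
cardinalities; it is `0` if `α` is empty or infinite. -/
noncomputable def pr (E : α → Prop) : ℝ :=
  (Nat.card {a // E a} : ℝ) / Nat.card α

lemma pr_nonneg (E : α → Prop) : 0 ≤ pr E := by
  unfold pr
  positivity

lemma pr_comp_equiv (e : α ≃ β) (E : β → Prop) : pr (fun a => E (e a)) = pr E := by
  unfold pr
  rw [Nat.card_congr e, Nat.card_congr (e.subtypeEquiv (p := fun a => E (e a)) fun _ => Iff.rfl)]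

open Classical in
lemma natCard_subtype_eq_sum [Fintype α] (E : α → Prop) :
    (Nat.card {a // E a} : ℝ) = ∑ a, if E a then 1 else 0 := by
  rw [Nat.card_eq_fintype_card, Fintype.card_subtype, Finset.sum_boole]

open Classical in
lemma pr_eq_expect [Fintype α] (E : α → Prop) : pr E = 𝔼 a, if E a then 1 else 0 := by
  rw [pr, natCard_subtype_eq_sum, Nat.card_eq_fintype_card, Fintype.expect_eq_sum_div_card]

lemma pr_eq_expect_resample [Fintype α] [Finite β] [Nonempty β] (τ : β → α ≃ α) (E : α → Prop) :
    pr E = 𝔼 a, pr fun b => E (τ b a) := by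
  classical
  have := Fintype.ofFinite β
  calc pr E = 𝔼 b : β, pr fun a => E (τ b a) := by
        simp only [pr_comp_equiv, Fintype.expect_const]
    _ = 𝔼 a, pr fun b => E (τ b a) := by
        simp only [pr_eq_expect]
        exact Finset.expect_comm _ _ _

variable [Finite α]

lemma pr_mono {E E' : α → Prop} (h : ∀ a, E a → E' a) : pr E ≤ pr E' := by
  unfold pr
  gcongr
  exact Nat.card_mono (Set.toFinite {a | E' a}) h

lemma pr_le_one (E : α → Prop) : pr E ≤ 1 := by
  refine div_le_one_of_le₀ ?_ (Nat.cast_nonneg _)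
  exact_mod_cast Finite.card_subtype_le E

lemma pr_not [Nonempty α] (E : α → Prop) : pr (fun a => ¬ E a) = 1 - pr E := by
  classical
  have := Fintype.ofFinite α
  rw [eq_sub_iff_add_eq, pr_eq_expect, pr_eq_expect, ← Finset.expect_add_distrib]
  refine (Finset.expect_congr rfl fun a _ => ?_).trans (Fintype.expect_const 1)
  by_cases h : E a <;> simp [h]

lemma pr_le_add {E E₁ E₂ : α → Prop} (h : ∀ a, E a → E₁ a ∨ E₂ a) : pr E ≤ pr E₁ + pr E₂ := by
  classical
  have := Fintype.ofFinite α
  simp only [pr_eq_expect, ← Finset.expect_add_distrib]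
  refine Finset.expect_le_expect fun a _ => ?_
  specialize h a
  by_cases h₁ : E₁ a <;> by_cases h₂ : E₂ a <;> by_cases hE : E a <;> simp_all

lemma pr_le_card_mul_div [Finite β] {E : α → Prop} {R : β → α → Prop} {T c : ℝ} (hT : 0 < T)
    (h : ∀ a, E a → T ≤ Nat.card {y // R y a}) (hR : ∀ y, pr (R y) ≤ c) :
    pr E ≤ Nat.card β * c / T := by
  classical
  have := Fintype.ofFinite α
  have := Fintype.ofFinite β
  rw [le_div_iff₀ hT]
  calc pr E * T = 𝔼 a, (if E a then 1 else 0) * T := by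
        rw [pr_eq_expect, Finset.expect_mul]
    _ ≤ 𝔼 a, ∑ y, if R y a then 1 else 0 := by
        refine Finset.expect_le_expect fun a _ => ?_
        rw [← natCard_subtype_eq_sum fun y => R y a]
        split_ifs with hE
        · simpa using h a hE
        · simp
    _ = ∑ y, pr (R y) := by
        simp only [pr_eq_expect, Finset.expect_sum_comm]
    _ ≤ ∑ _y : β, c := Finset.sum_le_sum fun y _ => hR y
    _ = Nat.card β * c := by simp

lemma pr_le_card_mul [Finite β] {E : α → Prop} {R : β → α → Prop} {c : ℝ}
    (h : ∀ a, E a → ∃ y, R y a) (hR : ∀ y, pr (R y) ≤ c) : pr E ≤ Nat.card β * c := by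
  rw [← div_one (Nat.card β * c)]
  refine pr_le_card_mul_div one_pos (fun a ha => ?_) hR
  have : Nonempty {y // R y a} := nonempty_subtype.mpr (h a ha)
  exact_mod_cast Nat.card_pos

lemma pr_le_of_resample [Nonempty α] [Finite β] [Nonempty β] (τ : β → α ≃ α) {E : α → Prop}
    {c : ℝ} (h : ∀ a, pr (fun b => E (τ b a)) ≤ c) : pr E ≤ c := by
  have := Fintype.ofFinite α
  rw [pr_eq_expect_resample τ E]
  exact Finset.expect_le Finset.univ_nonempty fun a _ => h a

lemma pr_map_of_surjective {G H : Type*} [AddGroup G] [AddGroup H] [Finite G] (φ : G →+ H)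
    (hφ : Function.Surjective φ) (P : H → Prop) : pr (fun g => P (φ g)) = pr P := by
  have := Fintype.ofFinite G
  have := Finite.of_surjective φ hφ
  rw [pr_eq_expect_resample (fun h => Equiv.addRight (Function.surjInv hφ h))]
  simp only [Equiv.coe_addRight, map_add, Function.surjInv_eq hφ]
  exact (Finset.expect_congr rfl fun g _ => pr_comp_equiv (Equiv.addLeft (φ g)) P).trans
    (Fintype.expect_const _)

lemma pr_eval {ι G : Type*} [Finite ι] [AddGroup G] [Finite G] (i : ι) (P : G → Prop) :
    pr (fun f : ι → G => P (f i)) = pr P :=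
  pr_map_of_surjective (Pi.evalAddMonoidHom (fun _ : ι => G) i) (Function.surjective_eval i) P

end UniformProbability

section RandomMatrix

variable {F : Type*} [Field F] {ι κ : Type*}

lemma pr_mem_submodule [Fintype ι] (A : Submodule F (ι → F)) :
    pr (· ∈ A) = (Nat.card F : ℝ) ^ Module.finrank F A / (Nat.card F : ℝ) ^ Fintype.card ι := by
  unfold pr
  rw [← Nat.cast_pow, ← Module.natCard_eq_pow_finrank, Nat.card_fun,
    Nat.card_eq_fintype_card (α := ι), Nat.cast_pow]

variable [Finite F] [Fintype κ]

lemma pr_vecMul [Finite ι] {y : κ → F} (hy : y ≠ 0) (P : (ι → F) → Prop) :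
    pr (fun M : Matrix κ ι F => P (y ᵥ* M)) = pr P := by
  classical
  obtain ⟨i, hi⟩ := Function.ne_iff.mp hy
  refine pr_map_of_surjective (AddMonoidHom.mk' (fun M : Matrix κ ι F => y ᵥ* M)
    fun M N => Matrix.vecMul_add M N y) (fun b => ?_) P
  refine ⟨Matrix.vecMulVec (Pi.single i (y i)⁻¹) b, ?_⟩
  rw [AddMonoidHom.mk'_apply, Matrix.vecMul_vecMulVec, dotProduct_single, mul_inv_cancel₀ hi,
    one_smul]

variable [Fintype ι]

lemma pr_exists_vecMul_mem_le (B : Submodule F (κ → F)) (A : Submodule F (ι → F))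
    (h : Module.finrank F B + Module.finrank F A ≤ Fintype.card ι) :
    pr (fun M : Matrix κ ι F => ∃ y ∈ B, y ≠ 0 ∧ y ᵥ* M ∈ A) ≤ 2 / Nat.card F := by
  have hq : (2 : ℝ) ≤ Nat.card F := by exact_mod_cast Finite.one_lt_card (α := F)
  have hunits : (Nat.card Fˣ : ℝ) = Nat.card F - 1 := by
    rw [Nat.card_units, Nat.cast_pred Nat.card_pos]
  have hmult : ∀ M : Matrix κ ι F, (∃ y ∈ B, y ≠ 0 ∧ y ᵥ* M ∈ A) →
      (Nat.card Fˣ : ℝ) ≤ Nat.card {y : {y : B // y ≠ 0} // (y : κ → F) ᵥ* M ∈ A} := by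
    rintro M ⟨y, hyB, hy, hyM⟩
    let f (u : Fˣ) : {y : {y : B // y ≠ 0} // (y : κ → F) ᵥ* M ∈ A} :=
      ⟨⟨⟨(u : F) • y, B.smul_mem _ hyB⟩, fun h0 => hy (by simpa using congrArg Subtype.val h0)⟩, by
        simpa only [Matrix.smul_vecMul] using A.smul_mem (u : F) hyM⟩
    have hf : Function.Injective f := fun u w huw => Units.ext <| smul_left_injective F hy <|
      congrArg (fun z : {y : {y : B // y ≠ 0} // (y : κ → F) ᵥ* M ∈ A} => (z : κ → F)) huw
    exact_mod_cast Nat.card_le_card_of_injective f hf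
  have hcount : Nat.card {y : B // y ≠ 0} * pr (· ∈ A) ≤ 1 := by
    have hle : (Nat.card {y : B // y ≠ 0} : ℝ) ≤ (Nat.card F : ℝ) ^ Module.finrank F B := by
      exact_mod_cast (Finite.card_subtype_le _).trans_eq Module.natCard_eq_pow_finrank
    calc _ ≤ (Nat.card F : ℝ) ^ Module.finrank F B * pr (· ∈ A) := by
          gcongr
          exact pr_nonneg _
      _ ≤ 1 := by
          rw [pr_mem_submodule, mul_div_assoc', ← pow_add]
          exact div_le_one_of_le₀ (pow_le_pow_right₀ (by linarith) h) (by positivity)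
  calc _ ≤ Nat.card {y : B // y ≠ 0} * pr (· ∈ A) / Nat.card Fˣ :=
        pr_le_card_mul_div (by rw [hunits]; linarith) hmult fun y =>
          (pr_vecMul (fun h0 => y.2 (Subtype.ext h0)) (· ∈ A)).le
    _ ≤ 1 / (Nat.card F - 1) := by
        rw [hunits]
        gcongr
        linarith
    _ ≤ 2 / Nat.card F := by
        rw [div_le_div_iff₀ (by linarith) (by linarith)]
        linarith

lemma pr_exists_mulVec_mem_le (A : Submodule F (κ → F))
    (hA : Module.finrank F A + Fintype.card ι ≤ Fintype.card κ) :
    pr (fun M : Matrix κ ι F => ∃ c, c ≠ 0 ∧ M *ᵥ c ∈ A) ≤ 2 / Nat.card F := by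
  rw [← pr_comp_equiv (Matrix.transposeAddEquiv ι κ F).toEquiv]
  simpa [Matrix.mulVec_transpose] using
    pr_exists_vecMul_mem_le (κ := ι) ⊤ A (by simpa [add_comm] using hA)

lemma pr_sup_range_mulVecLin_ne_top_le (A : Submodule F (κ → F))
    (hA : Fintype.card κ ≤ Module.finrank F A + Fintype.card ι) :
    pr (fun M : Matrix κ ι F => A ⊔ LinearMap.range M.mulVecLin ≠ ⊤) ≤ 2 / Nat.card F := by
  classical
  let B : Submodule F (κ → F) := A.dualAnnihilator.comap (dotProductEquiv F κ).toLinearMap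
  have hB : Module.finrank F B + Module.finrank F (⊥ : Submodule F (ι → F)) ≤ Fintype.card ι := by
    have h₁ := Subspace.finrank_add_finrank_dualAnnihilator_eq A
    have h₂ : Module.finrank F B = Module.finrank F A.dualAnnihilator :=
      ((dotProductEquiv F κ).ofSubmodule' A.dualAnnihilator).finrank_eq
    rw [Module.finrank_fintype_fun_eq_card] at h₁
    rw [finrank_bot]
    omega
  refine (pr_mono fun M hM => ?_).trans (pr_exists_vecMul_mem_le B ⊥ hB)
  obtain ⟨f, hf0, hf⟩ := Submodule.exists_le_ker_of_lt_top _ hM.lt_top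
  obtain ⟨y, rfl⟩ := (dotProductEquiv F κ).surjective f
  refine ⟨y, ?_, by simpa using hf0, ?_⟩
  · exact (Submodule.mem_dualAnnihilator _).mpr fun a ha => hf (Submodule.mem_sup_left ha)
  · refine (Submodule.mem_bot F).mpr (funext fun j => ?_)
    have hj : y ⬝ᵥ M *ᵥ Pi.single j 1 = 0 :=
      hf (Submodule.mem_sup_right ⟨Pi.single j 1, rfl⟩)
    rwa [Matrix.dotProduct_mulVec, dotProduct_single, mul_one] at hj

omit [Fintype κ] in
lemma pr_not_inf_eq_bot_or_sup_eq_top_le [Finite κ] (A : Submodule F (κ → F)) :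
    pr (fun M : Matrix κ ι F =>
      ¬ (A ⊓ LinearMap.range M.mulVecLin = ⊥ ∨ A ⊔ LinearMap.range M.mulVecLin = ⊤)) ≤
      2 / Nat.card F := by
  have := Fintype.ofFinite κ
  rcases le_total (Module.finrank F A + Fintype.card ι) (Fintype.card κ) with h | h
  · refine (pr_mono fun M hM => ?_).trans (pr_exists_mulVec_mem_le A h)
    obtain ⟨_, ⟨hxA, c, rfl⟩, hx⟩ := (Submodule.ne_bot_iff _).mp (not_or.mp hM).1
    exact ⟨c, fun hc => hx (by rw [hc, map_zero]), hxA⟩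
  · exact (pr_mono fun M hM => (not_or.mp hM).2).trans (pr_sup_range_mulVecLin_ne_top_le A h)

lemma pr_finrank_range_mulVecLin_ne_le (h : Fintype.card ι ≤ Fintype.card κ) :
    pr (fun M : Matrix κ ι F => Module.finrank F (LinearMap.range M.mulVecLin) ≠ Fintype.card ι) ≤
      2 / Nat.card F := by
  refine (pr_mono fun M hM => ?_).trans (pr_exists_mulVec_mem_le ⊥ (by simpa using h))
  by_contra! hinj
  refine hM ((LinearMap.finrank_range_of_inj ?_).trans (Module.finrank_fintype_fun_eq_card F))
  refine (injective_iff_map_eq_zero M.mulVecLin).mpr fun c hc => ?_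
  by_contra hc0
  exact hinj c hc0 ((Submodule.mem_bot F).mpr hc)

end RandomMatrix

section RandomInstance

variable {F : Type} [Field F] {K d m m' : ℕ}

/-- The instance with the given matrices for user `k` and zero matrices for the others; adding it
to an instance modifies a single user. -/
def singleUser (k : Fin K) (M : Matrix (Fin d) (Fin m ⊕ Fin m') F) : Inst F K d m m' :=
  (Pi.single k M.toCols₁, Pi.single k M.toCols₂)

lemma userMatrix_add_singleUser_self (Λ : Inst F K d m m') (k : Fin K)
    (M : Matrix (Fin d) (Fin m ⊕ Fin m') F) :
    userMatrix (Λ + singleUser k M) k = userMatrix Λ k + M := by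
  ext i (j | j) <;> simp [userMatrix, singleUser, Inst.v, Inst.v']

lemma userMatrix_add_singleUser_of_ne (Λ : Inst F K d m m') {k l : Fin K} (h : l ≠ k)
    (M : Matrix (Fin d) (Fin m ⊕ Fin m') F) :
    userMatrix (Λ + singleUser k M) l = userMatrix Λ l := by
  ext i (j | j) <;> simp [userMatrix, singleUser, Inst.v, Inst.v', h]

lemma uncross_userSpaceSeq_add_singleUser (Λ : Inst F K d m m') (k : Fin K)
    (M : Matrix (Fin d) (Fin m ⊕ Fin m') F) :
    uncross (userSpaceSeq (Λ + singleUser k M)) k = uncross (userSpaceSeq Λ) k := by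
  refine uncross_congr fun i hi => ?_
  have hiK := hi.trans k.2
  rw [userSpaceSeq, userSpaceSeq, dif_pos hiK, dif_pos hiK, userSpace, userSpace,
    userMatrix_add_singleUser_of_ne _ (Fin.ne_of_lt hi)]

variable [Finite F]

lemma pr_userMatrix_le (k : Fin K)
    {E : Inst F K d m m' → Matrix (Fin d) (Fin m ⊕ Fin m') F → Prop} {c : ℝ}
    (hE : ∀ Λ M, E (Λ + singleUser k M) = E Λ) (h : ∀ Λ, pr (E Λ) ≤ c) :
    pr (fun Λ => E Λ (userMatrix Λ k)) ≤ c := by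
  refine pr_le_of_resample (fun M => Equiv.addRight (singleUser k M)) fun Λ => ?_
  simp only [Equiv.coe_addRight, hE, userMatrix_add_singleUser_self]
  exact (pr_comp_equiv (Equiv.addLeft (userMatrix Λ k)) (E Λ)).trans_le (h Λ)

lemma pr_finrank_userSpace_ne_le (k : Fin K) (hd : m + m' ≤ d) :
    pr (fun Λ : Inst F K d m m' => Module.finrank F (userSpace Λ k) ≠ m + m') ≤
      2 / Nat.card F := by
  refine pr_userMatrix_le k
    (E := fun _ M => Module.finrank F (LinearMap.range M.mulVecLin) ≠ m + m') (fun _ _ => rfl)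
    fun _ => ?_
  simpa using pr_finrank_range_mulVecLin_ne_le (F := F) (ι := Fin m ⊕ Fin m') (κ := Fin d)
    (by simpa using hd)

lemma pr_userSpace_ne_top_le (k : Fin K) (hd : d ≤ m + m') :
    pr (fun Λ : Inst F K d m m' => userSpace Λ k ≠ ⊤) ≤ 2 / Nat.card F := by
  refine pr_userMatrix_le k (E := fun _ M => LinearMap.range M.mulVecLin ≠ ⊤) (fun _ _ => rfl)
    fun _ => ?_
  simpa using pr_sup_range_mulVecLin_ne_top_le (ι := Fin m ⊕ Fin m')
    (⊥ : Submodule F (Fin d → F)) (by simpa using hd)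

lemma pr_not_uncross_inf_eq_bot_or_sup_eq_top_le (k : Fin K) :
    pr (fun Λ : Inst F K d m m' => ¬ (uncross (userSpaceSeq Λ) k ⊓ userSpace Λ k = ⊥ ∨
      uncross (userSpaceSeq Λ) k ⊔ userSpace Λ k = ⊤)) ≤ 2 / Nat.card F := by
  let E (Λ : Inst F K d m m') (M : Matrix (Fin d) (Fin m ⊕ Fin m') F) : Prop :=
    ¬ (uncross (userSpaceSeq Λ) k ⊓ LinearMap.range M.mulVecLin = ⊥ ∨
      uncross (userSpaceSeq Λ) k ⊔ LinearMap.range M.mulVecLin = ⊤)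
  have hE (Λ : Inst F K d m m') (M : Matrix (Fin d) (Fin m ⊕ Fin m') F) :
      E (Λ + singleUser k M) = E Λ := by
    simp only [E, uncross_userSpaceSeq_add_singleUser]
  have hpr (Λ : Inst F K d m m') : pr (E Λ) ≤ 2 / Nat.card F :=
    pr_not_inf_eq_bot_or_sup_eq_top_le (uncross (userSpaceSeq Λ) k)
  exact pr_userMatrix_le (E := E) k hE hpr

lemma pr_not_inGeneralPosition_le {N : ℕ} (hNK : N ≤ K) (hd : m + m' ≤ d) :
    pr (fun Λ : Inst F K d m m' => ¬ InGeneralPosition (userSpaceSeq Λ) (m + m') N) ≤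
      N * (4 / Nat.card F) := by
  let k (i : Fin N) : Fin K := Fin.castLE hNK i
  let E (i : Fin N) (Λ : Inst F K d m m') : Prop :=
    Module.finrank F (userSpace Λ (k i)) = m + m' ∧
      (uncross (userSpaceSeq Λ) i ⊓ userSpace Λ (k i) = ⊥ ∨
        uncross (userSpaceSeq Λ) i ⊔ userSpace Λ (k i) = ⊤)
  have hE (i : Fin N) : pr (fun Λ => ¬ E i Λ) ≤ 4 / Nat.card F :=
    calc _ ≤ 2 / (Nat.card F : ℝ) + 2 / Nat.card F :=
          (pr_le_add fun Λ => not_and_or.mp).trans (add_le_add (pr_finrank_userSpace_ne_le (k i) hd)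
            (pr_not_uncross_inf_eq_bot_or_sup_eq_top_le (k i)))
      _ = 4 / Nat.card F := by ring
  have hbad (Λ : Inst F K d m m') (h : ¬ InGeneralPosition (userSpaceSeq Λ) (m + m') N) :
      ∃ i, ¬ E i Λ := by
    by_contra! hgood
    refine h fun i hi => ?_
    rw [userSpaceSeq, dif_pos (hi.trans_le hNK)]
    exact hgood ⟨i, hi⟩
  simpa using pr_le_card_mul hbad hE

end RandomInstance

section RandomCoding

variable {F : Type} [Field F] [Finite F] {K d m m' : ℕ}

lemma pr_exists_mem_vecMul_v'_eq_zero_le (k : Fin K) {B : Submodule F (Fin d → F)}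
    (hB : Module.finrank F B ≤ m') :
    pr (fun Λ : Inst F K d m m' => ∃ x ∈ B, x ≠ 0 ∧ x ᵥ* Λ.v' k = 0) ≤ 2 / Nat.card F := by
  let ψ : Inst F K d m m' →+ Matrix (Fin d) (Fin m') F :=
    AddMonoidHom.mk' (fun Λ => Λ.v' k) fun _ _ => rfl
  have hψ : Function.Surjective ψ := fun M => ⟨(0, fun _ => M), rfl⟩
  refine (pr_map_of_surjective ψ hψ fun M => ∃ x ∈ B, x ≠ 0 ∧ x ᵥ* M = 0).trans_le ?_
  simpa using pr_exists_vecMul_mem_le (ι := Fin m') B ⊥ (by simpa using hB)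

lemma pr_sub_lt_optCost_le :
    pr (fun Λ : Inst F K d m m' => ((d - m' : ℕ) : ℝ) < optCost Λ) ≤ K * (2 / Nat.card F) := by
  let φ : (Fin d → F) →ₗ[F] Fin (d - m') → F := LinearMap.funLeft F F (Fin.castLE (d.sub_le m'))
  have hφ : Module.finrank F (LinearMap.ker φ) ≤ m' := by
    have hrank := φ.finrank_range_add_finrank_ker
    rw [LinearMap.range_eq_top.mpr
      (LinearMap.funLeft_surjective_of_injective F F _ (Fin.castLE_injective _)), finrank_top,
      Module.finrank_fin_fun, Module.finrank_fin_fun] at hrank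
    omega
  have hbad (Λ : Inst F K d m m') (h : ((d - m' : ℕ) : ℝ) < optCost Λ) :
      ∃ k, ∃ x ∈ LinearMap.ker φ, x ≠ 0 ∧ x ᵥ* Λ.v' k = 0 := by
    contrapose! h
    rw [← logb_natCard_fin_fun (F := F)]
    refine optCost_le_logb_card φ.toAddMonoidHom fun k x hx hxk => ?_
    rw [by_contra fun hx0 => h k x hx hx0 hxk, Matrix.zero_vecMul]
  simpa using pr_le_card_mul hbad fun k => pr_exists_mem_vecMul_v'_eq_zero_le k hφ

end RandomCoding

section RandomAlignment

/-- Adding to the side-information of each user combinations of its demands. Unlike a fresh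
instance, a shear does not affect the subspaces aligned with the coefficients before it. -/
def shear {F : Type} [Field F] {K d m m' : ℕ} (P : Fin K → Matrix (Fin m) (Fin m') F) :
    Inst F K d m m' ≃ Inst F K d m m' where
  toFun Λ := (Λ.1, fun u => Λ.2 u + Λ.1 u * P u)
  invFun Λ := (Λ.1, fun u => Λ.2 u - Λ.1 u * P u)
  left_inv Λ := by simp
  right_inv Λ := by simp

lemma vecMul_apply_mem {k F ι κ : Type*} [Field k] [Field F] [Algebra k F] [Fintype κ]
    {Z Z₀ : Submodule k F} {M : Matrix κ ι F} {j : ι} (hZ : ∀ i, ∀ z ∈ Z, M i j * z ∈ Z₀)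
    {x : κ → F} (hx : ∀ i, x i ∈ Z) : (x ᵥ* M) j ∈ Z₀ :=
  Submodule.sum_mem _ fun i _ => mul_comm (M i j) (x i) ▸ hZ i (x i) (hx i)

lemma pr_exists_forall_and_forall_vecMul_le {F ι κ : Type*} [Field F] [Finite F] [Fintype ι]
    [Fintype κ] (X : F → Prop) :
    pr (fun M : Matrix κ ι F => ∃ y ≠ 0, (∀ i, X (y i)) ∧ ∀ j, X ((y ᵥ* M) j)) ≤
      (Nat.card {a // X a} : ℝ) ^ Fintype.card κ * pr X ^ Fintype.card ι := by
  have hpr : pr (fun b : ι → F => ∀ j, X (b j)) = pr X ^ Fintype.card ι := by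
    rw [pr, Nat.card_congr (Equiv.subtypePiEquivPi (p := fun _ => X)), Nat.card_pi, Nat.card_fun,
      Finset.prod_const, Finset.card_univ, Nat.card_eq_fintype_card (α := ι), pr, div_pow,
      Nat.cast_pow, Nat.cast_pow]
  have hcard : (Nat.card (κ → {a // X a}) : ℝ) = (Nat.card {a // X a} : ℝ) ^ Fintype.card κ := by
    rw [Nat.card_fun, Nat.card_eq_fintype_card (α := κ), Nat.cast_pow]
  rw [← hcard]
  refine pr_le_card_mul (R := fun (y : κ → {a // X a}) (M : Matrix κ ι F) =>
    (fun i => (y i : F)) ≠ 0 ∧ ∀ j, X (((fun i => (y i : F)) ᵥ* M) j))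
    (fun M ⟨y, hy, hyX, hM⟩ => ⟨fun i => ⟨y i, hyX i⟩, hy, hM⟩) fun y => ?_
  by_cases hy : (fun i => (y i : F)) = 0
  · have := pow_nonneg (pr_nonneg X) (Fintype.card ι)
    simpa [hy, pr] using this
  · exact (pr_mono fun M h => h.2).trans_eq ((pr_vecMul hy fun b => ∀ j, X (b j)).trans hpr)

variable {k F : Type} [Field k] [Finite k] [Field F] [Algebra k F] [FiniteDimensional k F]

lemma natCard_le_of_le_finrank_quotient {Z : Submodule k F} {M : ℕ} {a : ℝ}
    (h : a * Module.finrank k F ≤ Module.finrank k (F ⧸ Z) + M) :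
    (Nat.card Z : ℝ) ≤ (Nat.card k : ℝ) ^ M * (Nat.card F : ℝ) ^ (1 - a) := by
  have hk : (1 : ℝ) < Nat.card k := by exact_mod_cast Finite.one_lt_card (α := k)
  have hdim : (Module.finrank k (F ⧸ Z) : ℝ) + Module.finrank k Z = Module.finrank k F := by
    exact_mod_cast Z.finrank_quotient_add_finrank
  rw [Module.natCard_eq_pow_finrank (K := k) (V := Z),
    Module.natCard_eq_pow_finrank (K := k) (V := F)]
  push_cast
  rw [← Real.rpow_natCast, ← Real.rpow_natCast, ← Real.rpow_natCast, ← Real.rpow_mul (by linarith),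
    ← Real.rpow_add (by linarith)]
  exact Real.rpow_le_rpow_of_exponent_le hk.le (by linarith)

lemma logb_natCard_fun_quotient (d : ℕ) (Z : Submodule k F) :
    Real.logb (Nat.card F) (Nat.card (Fin d → F ⧸ Z)) =
      d * (Module.finrank k (F ⧸ Z) / Module.finrank k F) := by
  have hk : (1 : ℝ) < Nat.card k := by exact_mod_cast Finite.one_lt_card (α := k)
  rw [Nat.card_fun, Nat.card_eq_fintype_card (α := Fin d), Fintype.card_fin, Nat.cast_pow,
    Real.logb_pow, Module.natCard_eq_pow_finrank (K := k) (V := F),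
    Module.natCard_eq_pow_finrank (K := k) (V := F ⧸ Z), Real.logb, Nat.cast_pow, Nat.cast_pow,
    Real.log_pow, Real.log_pow, mul_div_mul_right _ _ (Real.log_pos hk).ne']

variable {K d m m' : ℕ}

lemma pr_exists_vecMul_mem_submodule_le {Z : Submodule k F} {M : ℕ} {a : ℝ}
    (h : a * Module.finrank k F ≤ Module.finrank k (F ⧸ Z) + M) :
    pr (fun P : Fin K → Matrix (Fin m) (Fin m') F =>
      ∃ u, ∃ y ≠ 0, (∀ i, y i ∈ Z) ∧ ∀ j, (y ᵥ* P u) j ∈ Z) ≤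
      K * (((Nat.card k : ℝ) ^ M) ^ (m + m') *
        (Nat.card F : ℝ) ^ ((m + m') * (1 - a) - m')) := by
  have : Finite F := Module.finite_of_finite k
  have hq : (0 : ℝ) < Nat.card F := by exact_mod_cast Nat.card_pos
  let E (M : Matrix (Fin m) (Fin m') F) : Prop :=
    ∃ y ≠ 0, (∀ i, y i ∈ Z) ∧ ∀ j, (y ᵥ* M) j ∈ Z
  have hE : pr E ≤ (Nat.card Z : ℝ) ^ m * pr (· ∈ Z) ^ m' := by
    simpa only [Fintype.card_fin] using
      pr_exists_forall_and_forall_vecMul_le (ι := Fin m') (κ := Fin m) (· ∈ Z)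
  have hpr (u : Fin K) : pr (fun P : Fin K → Matrix (Fin m) (Fin m') F => E (P u)) ≤
      (Nat.card Z : ℝ) ^ m * pr (· ∈ Z) ^ m' := (pr_eval u E).trans_le hE
  refine (pr_le_card_mul (fun _ => id) hpr).trans ?_
  rw [Nat.card_eq_fintype_card, Fintype.card_fin]
  refine mul_le_mul_of_nonneg_left ?_ (Nat.cast_nonneg _)
  calc (Nat.card Z : ℝ) ^ m * pr (· ∈ Z) ^ m'
      = (Nat.card Z : ℝ) ^ (m + m') * ((Nat.card F : ℝ) ^ m')⁻¹ := by
        rw [pr, div_pow, pow_add, mul_assoc, div_eq_mul_inv]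
    _ ≤ ((Nat.card k : ℝ) ^ M * (Nat.card F : ℝ) ^ (1 - a)) ^ (m + m') *
          ((Nat.card F : ℝ) ^ m')⁻¹ := by
        gcongr
        exact natCard_le_of_le_finrank_quotient h
    _ = ((Nat.card k : ℝ) ^ M) ^ (m + m') * (Nat.card F : ℝ) ^ ((m + m') * (1 - a) - m') := by
        rw [mul_pow, mul_assoc, ← Real.rpow_natCast _ m', ← Real.rpow_neg hq.le,
          ← Real.rpow_mul_natCast hq.le, ← Real.rpow_add hq, Nat.cast_add, mul_comm (1 - a),
          sub_eq_add_neg (((m : ℝ) + m') * (1 - a))]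

lemma optCost_shear_le {Z Z₀ : Submodule k F} {Λ : Inst F K d m m'}
    (hZ : ∀ u i j, ∀ z ∈ Z, userMatrix Λ u i j * z ∈ Z₀)
    {P : Fin K → Matrix (Fin m) (Fin m') F}
    (hP : ∀ u, ¬ ∃ y ≠ 0, (∀ i, y i ∈ Z₀) ∧ ∀ j, (y ᵥ* P u) j ∈ Z₀) :
    optCost (shear P Λ) ≤ d * (Module.finrank k (F ⧸ Z) / Module.finrank k F) := by
  have : Finite F := Module.finite_of_finite k
  have : Finite (F ⧸ Z) := Module.finite_of_finite k
  rw [← logb_natCard_fun_quotient]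
  refine optCost_le_logb_card (Z.mkQ.compLeft (Fin d)).toAddMonoidHom fun u x hx hxu => ?_
  have hxZ (i : Fin d) : x i ∈ Z := (Submodule.Quotient.mk_eq_zero Z).mp (congrFun hx i)
  have hxP : (x ᵥ* Λ.v u) ᵥ* P u = -(x ᵥ* Λ.v' u) := by
    rw [Matrix.vecMul_vecMul, eq_neg_iff_add_eq_zero, add_comm, ← Matrix.vecMul_add]
    exact hxu
  by_contra hne
  refine hP u ⟨x ᵥ* Λ.v u, hne, fun i => ?_, fun j => ?_⟩
  · exact vecMul_apply_mem (fun l => hZ u l (Sum.inl i)) hxZ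
  · rw [hxP]
    exact neg_mem (vecMul_apply_mem (fun l => hZ u l (Sum.inr j)) hxZ)

lemma pr_mul_lt_optCost_le {ε a : ℝ} {N : ℕ} (hε : 0 < ε) (ha₀ : 0 ≤ a) (ha₁ : a ≤ 1)
    (hN : ((N + 1 : ℕ) : ℝ) ^ Fintype.card (Fin K × Fin d × (Fin m ⊕ Fin m')) < (1 + ε) ^ N) :
    pr (fun Λ : Inst F K d m m' => d * ((1 + ε) * a) < optCost Λ) ≤
      K * (((Nat.card k : ℝ) ^
        (1 + N ^ Fintype.card (Fin K × Fin d × (Fin m ⊕ Fin m')))) ^ (m + m') *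
          (Nat.card F : ℝ) ^ ((m + m') * (1 - a) - m')) := by
  have : Finite F := Module.finite_of_finite k
  let n := Module.finrank k F
  have hn : (0 : ℝ) < n := by exact_mod_cast Module.finrank_pos (R := k) (M := F)
  have hD : ⌊a * n⌋₊ ≤ n := Nat.floor_le_of_le (mul_le_of_le_one_left hn.le ha₁)
  refine pr_le_of_resample shear fun Λ => ?_
  obtain ⟨Z, Z₀, hle, hge, hcodim, hZ⟩ := exists_aligned (k := k)
    (fun e : Fin K × Fin d × (Fin m ⊕ Fin m') => userMatrix Λ e.1 e.2.1 e.2.2) hε hN hD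
  have hrate : d * ((Module.finrank k (F ⧸ Z) : ℝ) / n) ≤ d * ((1 + ε) * a) := by
    gcongr
    rw [div_le_iff₀ hn, mul_assoc]
    refine hcodim.trans ?_
    gcongr
    exact (Nat.cast_le.mpr hle).trans (Nat.floor_le (by positivity))
  have hbad (P : Fin K → Matrix (Fin m) (Fin m') F)
      (h : d * ((1 + ε) * a) < optCost (shear P Λ)) :
      ∃ u, ∃ y ≠ 0, (∀ i, y i ∈ Z₀) ∧ ∀ j, (y ᵥ* P u) j ∈ Z₀ := by
    by_contra hP
    exact h.not_ge ((optCost_shear_le (fun u i j => hZ (u, i, j)) (not_exists.mp hP)).trans hrate)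
  refine (pr_mono hbad).trans (pr_exists_vecMul_mem_submodule_le
    ((Nat.lt_floor_add_one (a * n)).le.trans ?_))
  exact_mod_cast by omega

end RandomAlignment

section GenericCost

variable (p : ℕ) [Fact p.Prime]

instance finite_galoisField (n : ℕ) : Finite (GaloisField p n) :=
  Module.finite_of_finite (ZMod p)

lemma tendsto_natCard_galoisField :
    Tendsto (fun n => (Nat.card (GaloisField p n) : ℝ)) atTop atTop := by
  have hp : (1 : ℝ) < p := by exact_mod_cast (Fact.out : p.Prime).one_lt
  refine (tendsto_pow_atTop_atTop_of_one_lt hp).congr' ?_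
  filter_upwards [eventually_ne_atTop 0] with n hn
  rw [GaloisField.card p n hn, Nat.cast_pow]

lemma tendsto_mul_div_natCard_galoisField (C c : ℝ) :
    Tendsto (fun n => C * (c / Nat.card (GaloisField p n))) atTop (𝓝 0) := by
  simpa only [mul_zero] using
    ((tendsto_natCard_galoisField p).const_div_atTop c).const_mul C

variable {p} {K d m m' : ℕ}

lemma isGenericCost_of_tendsto {Δ : ℝ}
    (hlow : Tendsto (fun n => pr fun Λ : Inst (GaloisField p n) K d m m' => optCost Λ < Δ)
      atTop (𝓝 0))
    (hup : ∀ ε > 0, Tendsto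
      (fun n => pr fun Λ : Inst (GaloisField p n) K d m m' => Δ + ε ≤ optCost Λ) atTop (𝓝 0)) :
    IsGenericCost p K d m m' Δ := by
  intro ε hε
  have hlim := (hlow.add (hup ε hε)).const_sub 1
  rw [add_zero, sub_zero] at hlim
  refine tendsto_of_tendsto_of_tendsto_of_le_of_le hlim tendsto_const_nhds (fun n => ?_)
    fun n => pr_le_one _
  have hfar (Λ : Inst (GaloisField p n) K d m m') (h : ¬ |optCost Λ - Δ| < ε) :
      optCost Λ < Δ ∨ Δ + ε ≤ optCost Λ := by
    contrapose! h
    exact abs_lt.mpr ⟨by linarith, by linarith⟩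
  have hsum := pr_le_add hfar
  rw [pr_not] at hsum
  exact sub_le_comm.mp hsum

lemma tendsto_pr_sub_add_le_optCost {ε : ℝ} (hε : 0 < ε) :
    Tendsto (fun n => pr fun Λ : Inst (GaloisField p n) K d m m' =>
      ((d - m' : ℕ) : ℝ) + ε ≤ optCost Λ) atTop (𝓝 0) :=
  squeeze_zero (fun _ => pr_nonneg _)
    (fun _ => (pr_mono fun _ => (lt_add_of_pos_right _ hε).trans_le).trans pr_sub_lt_optCost_le)
    (tendsto_mul_div_natCard_galoisField p K 2)

lemma isGenericCost_zero (hd : d ≤ m') : IsGenericCost p K d m m' 0 := by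
  refine isGenericCost_of_tendsto ?_ fun ε hε => ?_
  · simp [pr, (optCost_nonneg _).not_gt]
  · simpa only [Nat.sub_eq_zero_of_le hd, Nat.cast_zero] using
      tendsto_pr_sub_add_le_optCost (p := p) (K := K) (d := d) (m := m) (m' := m') hε

lemma isGenericCost_sub (hK : 0 < d → 0 < K) (hd : m' ≤ d) (hd' : d ≤ m + m') :
    IsGenericCost p K d m m' (d - m') := by
  rcases d.eq_zero_or_pos with rfl | hd₀
  · obtain rfl : m' = 0 := by omega
    simpa using isGenericCost_zero (p := p) (K := K) (m := m) le_rfl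
  refine isGenericCost_of_tendsto ?_ fun ε hε => ?_
  · refine squeeze_zero (fun _ => pr_nonneg _) (fun n => (pr_mono fun Λ h htop => ?_).trans
      (pr_userSpace_ne_top_le ⟨0, hK hd₀⟩ hd'))
      ((tendsto_natCard_galoisField p).const_div_atTop 2)
    exact h.not_ge (le_optCost fun σ hσ => hσ.le_cost_of_userSpace_eq_top htop)
  · simpa only [Nat.cast_sub hd] using
      tendsto_pr_sub_add_le_optCost (p := p) (K := K) (d := d) (m := m) (m' := m') hε

lemma pr_optCost_lt_mul_div_le {F : Type} [Field F] [Finite F]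
    (hK : d / Nat.gcd d (m + m') ≤ K) (hs : 0 < m + m') (hd : m + m' ≤ d) :
    pr (fun Λ : Inst F K d m m' => optCost Λ < d * m / (m + m')) ≤
      (d / Nat.gcd d (m + m') : ℕ) * (4 / Nat.card F) := by
  let g := Nat.gcd d (m + m')
  have hmul : d / g * (m + m') = (m + m') / g * d := by
    rw [Nat.div_mul_right_comm (Nat.gcd_dvd_left _ _), Nat.div_mul_right_comm
      (Nat.gcd_dvd_right _ _), mul_comm d]
  have ht : 0 < (m + m') / g :=
    Nat.div_pos (Nat.gcd_le_right _ hs) (Nat.gcd_pos_of_pos_right _ hs)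
  refine (pr_mono fun Λ h hpos => ?_).trans (pr_not_inGeneralPosition_le hK hd)
  exact h.not_ge (le_optCost fun σ hσ =>
    hσ.le_cost_of_inGeneralPosition hK (hs.trans_le hd) ht hmul hpos)

lemma exists_alignment_parameters {r δ : ℝ} (hr₁ : r < 1) (hδ : 0 < δ) :
    ∃ ε > 0, ∃ a, r < a ∧ a ≤ 1 ∧ (1 + ε) * a < r + δ := by
  obtain ⟨a, hra, ha⟩ := exists_between (lt_min hr₁ (lt_add_of_pos_right r (half_pos hδ)))
  obtain ⟨ha₁, haδ⟩ := lt_min_iff.mp ha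
  exact ⟨δ / 2, half_pos hδ, a, hra, ha₁.le, by nlinarith⟩

lemma tendsto_pr_mul_div_add_le_optCost {ε : ℝ} (hd : 0 < d) (hs : 0 < m + m') (hε : 0 < ε) :
    Tendsto (fun n => pr fun Λ : Inst (GaloisField p n) K d m m' =>
      (d * m / (m + m') : ℝ) + ε ≤ optCost Λ) atTop (𝓝 0) := by
  have hs' : (0 : ℝ) < m + m' := by exact_mod_cast hs
  have hd' : (0 : ℝ) < d := by exact_mod_cast hd
  rcases m'.eq_zero_or_pos with rfl | hm'
  · have hlt (n) (Λ : Inst (GaloisField p n) K d m 0) :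
        optCost Λ < d * m / (m + (0 : ℕ)) + ε := by
      rw [Nat.cast_zero, add_zero] at hs' ⊢
      rw [mul_div_cancel_right₀ _ hs'.ne']
      exact (optCost_le Λ).trans_lt (lt_add_of_pos_right _ hε)
    simp only [(hlt _ _).not_ge]
    simp [pr]
  have hm'₀ : (0 : ℝ) < m' := by exact_mod_cast hm'
  have hr₁ : (m / (m + m') : ℝ) < 1 := (div_lt_one hs').mpr (lt_add_of_pos_right _ hm'₀)
  obtain ⟨ε₀, hε₀, a, hra, ha₁, ha⟩ :=
    exists_alignment_parameters hr₁ (div_pos hε hd')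
  obtain ⟨N, hN⟩ := exists_pow_lt (Fintype.card (Fin K × Fin d × (Fin m ⊕ Fin m'))) hε₀
  have hrate : d * ((1 + ε₀) * a) < d * m / (m + m') + ε := by
    calc d * ((1 + ε₀) * a) < d * (m / (m + m') + ε / d) := by gcongr
      _ = d * m / (m + m') + ε := by field_simp
  have hexp : 0 < m' - (m + m') * (1 - a) := by
    linarith [(div_lt_iff₀' hs').mp hra]
  refine squeeze_zero (fun _ => pr_nonneg _) (fun n => (pr_mono fun _ => hrate.trans_le).trans
    (pr_mul_lt_optCost_le (k := ZMod p) hε₀ ((by positivity : (0 : ℝ) ≤ _).trans hra.le) ha₁ hN)) ?_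
  simpa [Function.comp_def] using (((tendsto_rpow_neg_atTop hexp).comp
    (tendsto_natCard_galoisField p)).const_mul _).const_mul _

lemma isGenericCost_mul_div (hK : d / Nat.gcd d (m + m') ≤ K) (hs : 0 < m + m')
    (hd : m + m' ≤ d) : IsGenericCost p K d m m' (d * m / (m + m')) :=
  isGenericCost_of_tendsto
    (squeeze_zero (fun _ => pr_nonneg _) (fun _ => pr_optCost_lt_mul_div_le hK hs hd)
      (tendsto_mul_div_natCard_galoisField p _ 4))
    fun _ => tendsto_pr_mul_div_add_le_optCost (hs.trans_le hd) hs

end GenericCost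

end LCBC

theorem theorem2_general (p : ℕ) [Fact p.Prime] (K d m m' : ℕ) :
    (d ≤ m' → LCBC.IsGenericCost p K d m m' 0) ∧
    ((0 < d → 0 < K) → m' ≤ d → d ≤ m + m' → LCBC.IsGenericCost p K d m m' (d - m')) ∧
    (d / Nat.gcd d (m + m') ≤ K → 0 < m + m' → m + m' ≤ d →
      LCBC.IsGenericCost p K d m m' (d * m / (m + m'))) :=
  ⟨LCBC.isGenericCost_zero, LCBC.isGenericCost_sub, LCBC.isGenericCost_mul_div⟩

theorem theorem2 (p : ℕ) [Fact p.Prime] (K d m m' : ℕ)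
    (hK : d / Nat.gcd d (m + m') ≤ K) :
    (d ≤ m' → LCBC.IsGenericCost p K d m m' 0) ∧
    (m' ≤ d → d ≤ m + m' → LCBC.IsGenericCost p K d m m' ((d : ℝ) - (m' : ℝ))) ∧
    (m + m' < d → d ≤ K * (m + m') →
      LCBC.IsGenericCost p K d m m' ((d : ℝ) * (m : ℝ) / ((m : ℝ) + (m' : ℝ)))) := by
  obtain ⟨hzero, hsub, hdiv⟩ := theorem2_general p K d m m'
  refine ⟨hzero, hsub fun hd => ?_, fun hd hdK => hdiv hK ?_ hd.le⟩
  · exact (Nat.div_pos (Nat.gcd_le_left _ hd) (Nat.gcd_pos_of_pos_left _ hd)).trans_le hK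
  · exact Nat.pos_of_mul_pos_left ((Nat.zero_le _).trans_lt hd |>.trans_le hdK)
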